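/- All graphs are finite, simple and undirected. For a graph $H$ with $m$ vertices let $\lambda_1(H)\ge\lambda_2(H)\ge\dots\ge\lambda_m(H)$ be the eigenvalues, counted with multiplicity, of its $(0,1)$-adjacency matrix; $\lambda_1(H)$ is called the index of $H$. **The Generalized RS-theorem.** Let $G$ be a connected graph with a cut-vertex $u$ (a vertex whose removal increases the number of connected components), let $G_1,\dots,G_n$ be the connected components of $G-u$, and let $a>0$ be a real number. 1. If at most one of the graphs $G_1,\dots,G_n$ has index equal to $a$ and all the others have index less than $a$, then $\lambda_2(G)<a$. 2. If at least two of the graphs $G_1,\dots,G_n$ have index equal to $a$ and all the others have index at most $a$, then $\lambda_2(G)=a$. 3. If at least two of the graphs $G_1,\dots,G_n$ have index greater than $a$, then $\lambda_2(G)>a$. 4. If exactly one of the graphs $G_1,\dots,G_n$ has index greater than $a$, at least one of the remaining ones has index equal to $a$, and all the others have index less than $a$, then $\lambda_2(G)>a$. 5. If one of the graphs $G_1,\dots,G_n$, say $G_i$, has at least two vertices and satisfies $\lambda_1(G_i)>\lambda_2(G_i)>a$, and all the others have index less than $a$, then $\lambda_2(G)>a$. -/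

import Mathlib

namespace GraphSpectrum

open Classical in
/-- The `k`-th largest eigenvalue (`k = 1, 2, …`, counted with multiplicity) of the real
`(0,1)`-adjacency matrix of a finite simple graph `G`, so that
`eigenvalue G 1 ≥ eigenvalue G 2 ≥ … ≥ eigenvalue G (Nat.card V)`.
It is only meaningful for `1 ≤ k ≤ Nat.card V`; elsewhere it takes the placeholder value `0`. -/
noncomputable def eigenvalue {V : Type*} [Finite V] (G : SimpleGraph V) (k : ℕ) : ℝ :=
  letI : Fintype V := Fintype.ofFinite V
  if h : 1 ≤ k ∧ k ≤ Fintype.card V then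
    (G.isHermitian_adjMatrix ℝ).eigenvalues₀ ⟨k - 1, by omega⟩
  else 0

/-- The index of a graph: its largest eigenvalue. -/
noncomputable def index {V : Type*} [Finite V] (G : SimpleGraph V) : ℝ :=
  eigenvalue G 1

/-- The graph `G - u`, the subgraph of `G` induced on the vertices different from `u`. -/
abbrev deleteVertex {V : Type*} (G : SimpleGraph V) (u : V) :
    SimpleGraph ({u}ᶜ : Set V) :=
  G.induce ({u}ᶜ : Set V)

/-- A vertex of a finite graph is a cut-vertex if its removal increases the number of connected
components. -/
def IsCutVertex {V : Type*} (G : SimpleGraph V) (u : V) : Prop :=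
  Nat.card G.ConnectedComponent < Nat.card (deleteVertex G u).ConnectedComponent

end GraphSpectrum

/-! Everything is read off the quadratic form q_a(x) = xᵀ(A - a)x. If λ₂(G) ≥ a, it is nonnegative
on a plane, which meets every hyperplane nontrivially (`exists_form_nonneg_of_le`); if λ₂(G) ≤ a, it
is nonpositive on a hyperplane, which meets every plane nontrivially
(`exists_forall_form_nonpos_of_le`). On vectors vanishing at u the form is the sum of the forms of
the components of G - u (`form_eq_sum`), so the indices of the components control its sign.

Strictness in (1) and (4) rests on Perron's theorem. In the borderline case a null vector of the
semidefinite form is an eigenvector of G, and it is a Perron vector of one component extended by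
zero. Its eigenvalue equation fails at u, which has a neighbour in that component
(`shift_glue_single_ne_zero`). -/

namespace GraphSpectrum

open Matrix

/-! ### The quadratic form of A - a -/

open Classical in
/-- The linear map `x ↦ A x - a x`, where `A` is the adjacency matrix of `G`. -/
noncomputable def shift {V : Type*} [Finite V] (G : SimpleGraph V) (a : ℝ) :
    (V → ℝ) →ₗ[ℝ] (V → ℝ) :=
  letI : Fintype V := Fintype.ofFinite V
  (G.adjMatrix ℝ).mulVecLin - a • LinearMap.id

/-- The quadratic form `x ↦ xᵀ A x - a xᵀ x`, where `A` is the adjacency matrix of `G`. -/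
noncomputable def form {V : Type*} [Finite V] (G : SimpleGraph V) (a : ℝ) (x : V → ℝ) : ℝ :=
  letI : Fintype V := Fintype.ofFinite V
  ∑ v, x v * shift G a x v

open Classical in
theorem shift_apply {V : Type*} [Fintype V] (G : SimpleGraph V) (a : ℝ) (x : V → ℝ) (v : V) :
    shift G a x v = ∑ w, (if G.Adj v w then x w else 0) - a * x v := by
  simp [shift, Matrix.mulVec, dotProduct, SimpleGraph.adjMatrix_apply]
  congr!

theorem form_eq {V : Type*} [Fintype V] (G : SimpleGraph V) (a : ℝ) (x : V → ℝ) :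
    form G a x = ∑ v, x v * shift G a x v := by
  unfold form
  congr!

theorem form_sub_form {V : Type*} [Fintype V] (G : SimpleGraph V) (a b : ℝ) (x : V → ℝ) :
    form G a x - form G b x = (b - a) * ∑ v, x v * x v := by
  rw [form_eq, form_eq, ← Finset.sum_sub_distrib, Finset.mul_sum]
  refine Finset.sum_congr rfl fun v _ => ?_
  rw [shift_apply, shift_apply]
  ring

theorem form_lt_of_lt {V : Type*} [Finite V] (G : SimpleGraph V) {a b : ℝ} (h : a < b)
    {x : V → ℝ} (hx : x ≠ 0) : form G b x < form G a x := by
  cases nonempty_fintype V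
  obtain ⟨v, hv⟩ := Function.ne_iff.1 hx
  have : 0 < ∑ v, x v * x v :=
    Finset.sum_pos' (fun v _ => mul_self_nonneg _) ⟨v, Finset.mem_univ _, mul_self_pos.2 hv⟩
  have h2 := form_sub_form G a b x
  nlinarith [mul_pos (sub_pos.2 h) this]

theorem form_zero {V : Type*} [Finite V] (G : SimpleGraph V) (a : ℝ) : form G a 0 = 0 := by
  simp [form]

theorem form_le_of_le {V : Type*} [Finite V] (G : SimpleGraph V) {a b : ℝ} (h : a ≤ b)
    (x : V → ℝ) : form G b x ≤ form G a x := by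
  rcases h.eq_or_lt with rfl | h
  · rfl
  by_cases hx : x = 0
  · simp [hx, form_zero]
  · exact (form_lt_of_lt G h hx).le

/-! ### Spectral decomposition and the sign of the form -/

/-- Diagonalization of the adjacency matrix: `b` is an orthonormal eigenbasis, `c` its coordinate
functionals. -/
theorem exists_diagonalization {V : Type*} [Finite V] (G : SimpleGraph V) :
    ∃ (b : Fin (Nat.card V) → V → ℝ) (c : Fin (Nat.card V) → (V → ℝ) →ₗ[ℝ] ℝ),
      (∀ i j, c i (b j) = if i = j then 1 else 0) ∧
      (∀ a x, shift G a x = ∑ j : Fin (Nat.card V), ((eigenvalue G (j + 1) - a) * c j x) • b j) ∧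
      (∀ a x, form G a x = ∑ j : Fin (Nat.card V), (eigenvalue G (j + 1) - a) * c j x ^ 2) := by
  classical
  let : Fintype V := Fintype.ofFinite V
  have hn : Nat.card V = Fintype.card V := Nat.card_eq_fintype_card
  rw [hn]
  let hM := G.isHermitian_adjMatrix ℝ
  let B := hM.eigenvectorBasis.reindex (Fintype.equivOfCardEq (Fintype.card_fin _)).symm
  have hl (j : Fin (Fintype.card V)) : eigenvalue G (j + 1) = hM.eigenvalues₀ j := by
    rw [eigenvalue, dif_pos ⟨by omega, by have := j.2; omega⟩]
    simp only [Nat.add_sub_cancel]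
  have hb (j) : (G.adjMatrix ℝ) *ᵥ (B j).ofLp = eigenvalue G (j + 1) • (B j).ofLp := by
    rw [hl]
    have := hM.mulVec_eigenvectorBasis (Fintype.equivOfCardEq (Fintype.card_fin _) j)
    simpa [B, Matrix.IsHermitian.eigenvalues] using this
  let c : Fin (Fintype.card V) → (V → ℝ) →ₗ[ℝ] ℝ := fun j =>
    { toFun := fun x => (B j).ofLp ⬝ᵥ x
      map_add' := fun x y => dotProduct_add _ _ _
      map_smul' := fun r x => dotProduct_smul _ _ _ }
  have hc (j x) : c j x = (B j).ofLp ⬝ᵥ x := rfl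
  have hinner (x y : EuclideanSpace ℝ V) : inner ℝ x y = x.ofLp ⬝ᵥ y.ofLp := by
    simp [PiLp.inner_apply, dotProduct, mul_comm]
  have horth (i j) : (B i).ofLp ⬝ᵥ (B j).ofLp = if i = j then (1 : ℝ) else 0 := by
    rw [← hinner]
    exact orthonormal_iff_ite.1 B.orthonormal i j
  have hx (x : V → ℝ) : x = ∑ j, c j x • (B j).ofLp := by
    have h := B.sum_repr' (WithLp.toLp 2 x)
    have h2 := congrArg WithLp.ofLp h
    simp only [hinner] at h2
    rw [WithLp.ofLp_sum] at h2
    simpa [hc] using h2.symm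
  have hs (a : ℝ) (x : V → ℝ) :
      shift G a x = ∑ j : Fin (Fintype.card V), ((eigenvalue G (j + 1) - a) * c j x) • (B j).ofLp := by
    have : shift G a x = (G.adjMatrix ℝ) *ᵥ x - a • x := by simp [shift]
    rw [this]
    conv_lhs => rw [hx x]
    rw [Matrix.mulVec_sum, Finset.smul_sum, ← Finset.sum_sub_distrib]
    refine Finset.sum_congr rfl fun j _ => ?_
    rw [Matrix.mulVec_smul, hb, smul_smul, smul_smul, ← sub_smul]
    congr 1
    ring
  refine ⟨fun j => (B j).ofLp, c, horth, hs, fun a x => ?_⟩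
  have : form G a x = x ⬝ᵥ shift G a x := rfl
  rw [this, hs, dotProduct_sum]
  refine Finset.sum_congr rfl fun j _ => ?_
  rw [dotProduct_smul, dotProduct_comm, ← hc, smul_eq_mul]
  ring

theorem eigenvalue_antitone {V : Type*} [Finite V] (G : SimpleGraph V) {i j : ℕ} (hi : 1 ≤ i)
    (hij : i ≤ j) (hj : j ≤ Nat.card V) : eigenvalue G j ≤ eigenvalue G i := by
  classical
  let : Fintype V := Fintype.ofFinite V
  have hn : Nat.card V = Fintype.card V := Nat.card_eq_fintype_card
  rw [hn] at hj
  rw [eigenvalue, eigenvalue, dif_pos ⟨by omega, hj⟩, dif_pos ⟨hi, by omega⟩]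
  apply Matrix.IsHermitian.eigenvalues₀_antitone
  simp only [Fin.mk_le_mk]
  omega

/-- In eigencoordinates all terms are nonpositive, so a zero sum kills each term, and with it each
term of the shift. -/
theorem form_index_nonpos {V : Type*} [Finite V] (G : SimpleGraph V) (x : V → ℝ) :
    form G (index G) x ≤ 0 ∧ (form G (index G) x = 0 → shift G (index G) x = 0) := by
  obtain ⟨b, c, -, hs, hf⟩ := exists_diagonalization G
  have h (j : Fin (Nat.card V)) : (eigenvalue G (j + 1) - index G) * c j x ^ 2 ≤ 0 :=
    mul_nonpos_of_nonpos_of_nonneg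
      (sub_nonpos.2 (eigenvalue_antitone G le_rfl (by omega) j.2)) (sq_nonneg _)
  rw [hf, hs]
  refine ⟨Finset.sum_nonpos fun j _ => h j, fun h0 => Finset.sum_eq_zero fun j _ => ?_⟩
  have := (Finset.sum_eq_zero_iff_of_nonpos fun j _ => h j).1 h0 j (Finset.mem_univ _)
  rcases mul_eq_zero.1 this with h | h
  · simp [h]
  · simp [pow_eq_zero_iff (two_ne_zero) |>.1 h]

theorem exists_shift_index_eq_zero {V : Type*} [Finite V] [Nonempty V] (G : SimpleGraph V) :
    ∃ x ≠ 0, shift G (index G) x = 0 := by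
  obtain ⟨b, c, hbc, hs, -⟩ := exists_diagonalization G
  have hn : 0 < Nat.card V := Nat.card_pos
  refine ⟨b ⟨0, hn⟩, fun h => ?_, ?_⟩
  · have h1 := hbc ⟨0, hn⟩ ⟨0, hn⟩
    rw [h, map_zero, if_pos rfl] at h1
    exact zero_ne_one h1
  · rw [hs]
    refine Finset.sum_eq_zero fun j _ => ?_
    rw [hbc]
    split_ifs with hj
    · simp [hj, index]
    · simp

/-- On the span of two top eigenvectors the form at `a ≤ λ₂` is nonnegative; every hyperplane
meets this span. -/
theorem exists_form_nonneg_of_le {V : Type*} [Finite V] (G : SimpleGraph V) (hV : 2 ≤ Nat.card V)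
    {a : ℝ} (ha : a ≤ eigenvalue G 2) (l : (V → ℝ) →ₗ[ℝ] ℝ) :
    ∃ x ≠ 0, l x = 0 ∧ 0 ≤ form G a x ∧ (form G a x = 0 → shift G a x = 0) := by
  obtain ⟨b, c, hbc, hs, hf⟩ := exists_diagonalization G
  let i : Fin (Nat.card V) := ⟨0, by omega⟩
  let j : Fin (Nat.card V) := ⟨1, by omega⟩
  have hij : i ≠ j := by simp [i, j]
  obtain ⟨s, t, hst, hl⟩ : ∃ s t : ℝ, (s ≠ 0 ∨ t ≠ 0) ∧ l (s • b i + t • b j) = 0 := by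
    by_cases h : l (b i) = 0
    · exact ⟨1, 0, by simp, by simp [h]⟩
    · exact ⟨-l (b j), l (b i), Or.inr h, by simp; ring⟩
  set x := s • b i + t • b j with hx
  have hci : c i x = s := by simp [hx, hbc, hij]
  have hcj : c j x = t := by simp [hx, hbc, hij.symm]
  have h (k : Fin (Nat.card V)) : 0 ≤ (eigenvalue G (k + 1) - a) * c k x ^ 2 := by
    by_cases hk : (k : ℕ) + 1 ≤ 2
    · exact mul_nonneg (sub_nonneg.2 (ha.trans (eigenvalue_antitone G (by omega) hk hV)))
        (sq_nonneg _)
    · have hki : k ≠ i := fun h => by simp [h, i] at hk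
      have hkj : k ≠ j := fun h => by simp [h, j] at hk
      simp [hx, hbc, hki, hkj]
  refine ⟨x, fun h0 => ?_, hl, ?_, ?_⟩
  · rw [h0, map_zero] at hci hcj
    rcases hst with h | h
    · exact h hci.symm
    · exact h hcj.symm
  · rw [hf]
    exact Finset.sum_nonneg fun k _ => h k
  · rw [hf, hs]
    refine fun h0 => Finset.sum_eq_zero fun k _ => ?_
    have := (Finset.sum_eq_zero_iff_of_nonneg fun k _ => h k).1 h0 k (Finset.mem_univ _)
    rcases mul_eq_zero.1 this with h | h
    · simp [h]
    · simp [pow_eq_zero_iff (two_ne_zero) |>.1 h]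

/-- On the orthogonal complement of a top eigenvector the form at `a ≥ λ₂` is nonpositive. -/
theorem exists_forall_form_nonpos_of_le {V : Type*} [Finite V] (G : SimpleGraph V) {a : ℝ}
    (ha : eigenvalue G 2 ≤ a) :
    ∃ l : (V → ℝ) →ₗ[ℝ] ℝ, ∀ x, l x = 0 →
      form G a x ≤ 0 ∧ (form G a x = 0 → shift G a x = 0) := by
  obtain ⟨b, c, -, hs, hf⟩ := exists_diagonalization G
  -- The zero functional serves the empty graph, which has no top eigenvector.
  obtain ⟨l, hl⟩ : ∃ l : (V → ℝ) →ₗ[ℝ] ℝ, ∀ k : Fin (Nat.card V), (k : ℕ) = 0 → c k = l := by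
    by_cases h : 0 < Nat.card V
    · exact ⟨c ⟨0, h⟩, fun k hk => by congr 1; exact Fin.ext hk⟩
    · exact ⟨0, fun k => absurd k.2 (by omega)⟩
  refine ⟨l, fun x hx => ?_⟩
  have h (k : Fin (Nat.card V)) : (eigenvalue G (k + 1) - a) * c k x ^ 2 ≤ 0 := by
    by_cases hk : (k : ℕ) = 0
    · simp [hl k hk, hx]
    · exact mul_nonpos_of_nonpos_of_nonneg (sub_nonpos.2
        ((eigenvalue_antitone G (by omega) (by omega) k.2).trans ha)) (sq_nonneg _)
  rw [hf, hs]
  refine ⟨Finset.sum_nonpos fun j _ => h j, fun h0 => Finset.sum_eq_zero fun j _ => ?_⟩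
  have := (Finset.sum_eq_zero_iff_of_nonpos fun j _ => h j).1 h0 j (Finset.mem_univ _)
  rcases mul_eq_zero.1 this with h | h
  · simp [h]
  · simp [pow_eq_zero_iff (two_ne_zero) |>.1 h]

/-! ### Perron vectors of connected graphs -/

section Perron

variable {V : Type*} [Finite V] {G : SimpleGraph V}

/-- Adjacency entries are nonnegative and squares ignore signs; hence |x| is a maximizer whenever x
is. -/
theorem form_le_form_abs (G : SimpleGraph V) (a : ℝ) (x : V → ℝ) :
    form G a x ≤ form G a |x| := by
  classical
  cases nonempty_fintype V
  rw [form_eq, form_eq]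
  refine Finset.sum_le_sum fun v _ => ?_
  rw [shift_apply, shift_apply, mul_sub, mul_sub, Finset.mul_sum, Finset.mul_sum]
  have h : |x| v * (a * |x| v) = x v * (a * x v) := by
    rw [Pi.abs_apply, mul_left_comm, abs_mul_abs_self]
    ring
  rw [h]
  refine sub_le_sub_right (Finset.sum_le_sum fun w _ => ?_) _
  split_ifs
  · rw [Pi.abs_apply, Pi.abs_apply, ← abs_mul]
    exact le_abs_self _
  · simp

theorem form_eq_zero_of_shift_eq_zero {a : ℝ} {x : V → ℝ} (hx : shift G a x = 0) :
    form G a x = 0 := by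
  simp [form, hx]

theorem shift_index_abs_eq_zero {x : V → ℝ} (hx : shift G (index G) x = 0) :
    shift G (index G) |x| = 0 := by
  have h := form_index_nonpos G |x|
  refine h.2 (h.1.antisymm ?_)
  rw [← form_eq_zero_of_shift_eq_zero hx]
  exact form_le_form_abs _ _ _

/-- An eigenvector for the index of a connected graph has no zero coordinate. -/
theorem eq_zero_of_shift_index_eq_zero (hG : G.Connected) {x : V → ℝ}
    (hx : shift G (index G) x = 0) {w : V} (hw : x w = 0) : x = 0 := by
  classical
  cases nonempty_fintype V
  by_contra hne
  obtain ⟨z, hz⟩ := Function.ne_iff.1 hne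
  obtain ⟨p⟩ := hG.preconnected w z
  -- At the zero end of an edge from a zero to a nonzero coordinate, the equation for |x| makes a
  -- sum of nonnegative terms vanish although one is positive.
  obtain ⟨d, -, hd1, hd2⟩ := p.exists_boundary_dart {v | x v = 0} hw hz
  have h := congrFun (shift_index_abs_eq_zero hx) d.fst
  have hd1' : x d.fst = 0 := hd1
  rw [shift_apply] at h
  simp only [Pi.abs_apply, hd1', abs_zero, mul_zero, sub_zero, Pi.zero_apply] at h
  rw [Finset.sum_eq_zero_iff_of_nonneg fun v _ => by split_ifs <;> simp] at h
  have := h d.snd (Finset.mem_univ _)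
  rw [if_pos d.adj, abs_eq_zero] at this
  exact hd2 this

/-- An eigenvector for the index of a connected graph has constant sign. -/
theorem exists_mul_pos_of_shift_index_eq_zero (hG : G.Connected) {x : V → ℝ} (hx0 : x ≠ 0)
    (hx : shift G (index G) x = 0) : ∃ s : ℝ, ∀ v, 0 < s * x v := by
  have hne (v) : x v ≠ 0 := fun h => hx0 (eq_zero_of_shift_index_eq_zero hG hx h)
  obtain ⟨v₀⟩ := hG.nonempty
  -- This eigenvector vanishes at `v₀`, hence everywhere, so x is proportional to |x|.
  have hy : |x v₀| • x - x v₀ • |x| = 0 := by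
    refine eq_zero_of_shift_index_eq_zero hG (w := v₀) ?_ ?_
    · simp [hx, shift_index_abs_eq_zero hx]
    · simp [mul_comm]
  refine ⟨x v₀, fun v => ?_⟩
  have h := congrFun hy v
  simp only [Pi.sub_apply, Pi.smul_apply, smul_eq_mul, Pi.abs_apply, Pi.zero_apply] at h
  have h1 : 0 < |x v₀| := abs_pos.2 (hne v₀)
  have h2 : 0 < x v₀ ^ 2 * |x v| := mul_pos (sq_pos_of_ne_zero (hne v₀)) (abs_pos.2 (hne v))
  refine pos_of_mul_pos_right (a := |x v₀|) ?_ h1.le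
  have : |x v₀| * (x v₀ * x v) = x v₀ ^ 2 * |x v| := by linear_combination x v₀ * h
  rwa [this]

theorem form_neg_of_index_lt {a : ℝ} (ha : index G < a) {x : V → ℝ} (hx : x ≠ 0) :
    form G a x < 0 :=
  (form_lt_of_lt G ha hx).trans_le (form_index_nonpos G x).1

theorem form_nonpos_of_index_le {a : ℝ} (ha : index G ≤ a) (x : V → ℝ) : form G a x ≤ 0 :=
  (form_le_of_le G ha x).trans (form_index_nonpos G x).1

theorem form_smul (G : SimpleGraph V) (a s : ℝ) (x : V → ℝ) :
    form G a (s • x) = s ^ 2 * form G a x := by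
  cases nonempty_fintype V
  rw [form_eq, form_eq, Finset.mul_sum]
  refine Finset.sum_congr rfl fun v _ => ?_
  rw [map_smul]
  simp only [Pi.smul_apply, smul_eq_mul]
  ring

end Perron

/-! ### Splitting the form over the components of G - u -/

section Glue

/-- The vertices of a connected component, as a type. -/
abbrev ComponentVertex {W : Type*} {H : SimpleGraph W} (C : H.ConnectedComponent) : Type _ :=
  {w : W // w ∈ C}

variable {V : Type*} (G : SimpleGraph V) (u : V)

/-- The restriction of a vector to a component of `G - u`. -/
def restrict (x : V → ℝ) (C : (deleteVertex G u).ConnectedComponent) : ComponentVertex C → ℝ :=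
  fun v => x v.1.1

open Classical in
/-- The vector which vanishes at `u` and has prescribed restrictions to the components of
`G - u`. -/
noncomputable def glue :
    (∀ C : (deleteVertex G u).ConnectedComponent, ComponentVertex C → ℝ) →ₗ[ℝ] (V → ℝ) where
  toFun y v := if h : v = u then 0 else
    y ((deleteVertex G u).connectedComponentMk ⟨v, h⟩) ⟨⟨v, h⟩, rfl⟩
  map_add' y z := by
    ext v
    by_cases h : v = u <;> simp [h]
  map_smul' r y := by
    ext v
    by_cases h : v = u <;> simp [h]

variable {G u}

theorem glue_self (y : ∀ C : (deleteVertex G u).ConnectedComponent, ComponentVertex C → ℝ) :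
    glue G u y u = 0 := by
  simp [glue]

theorem restrict_glue (y : ∀ C : (deleteVertex G u).ConnectedComponent, ComponentVertex C → ℝ) :
    restrict G u (glue G u y) = y := by
  ext C ⟨⟨v, hv⟩, rfl⟩
  have : v ≠ u := hv
  simp [restrict, glue, this]

theorem glue_restrict {x : V → ℝ} (hx : x u = 0) : glue G u (restrict G u x) = x := by
  ext v
  by_cases h : v = u
  · simp [glue, h, hx]
  · simp [glue, restrict, h]

variable [Finite V]

/-- A neighbour of v outside C can only be u, where x vanishes. -/
theorem shift_apply_of_mem {x : V → ℝ} (hx : x u = 0) (a : ℝ)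
    (C : (deleteVertex G u).ConnectedComponent) (v : ComponentVertex C) :
    shift G a x v.1.1 = shift C.toSimpleGraph a (restrict G u x C) v := by
  classical
  cases nonempty_fintype V
  let := Fintype.ofFinite (ComponentVertex C)
  rw [shift_apply, shift_apply]
  congr 1
  symm
  refine Fintype.sum_of_injective (fun w : ComponentVertex C => w.1.1)
    (Subtype.val_injective.comp Subtype.val_injective) _ _ (fun w hw => ?_) fun w => ?_
  · by_cases hwu : w = u
    · simp [hwu, hx]
    · refine if_neg fun hadj => hw ⟨⟨⟨w, hwu⟩, ?_⟩, rfl⟩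
      have h : (deleteVertex G u).Adj v.1 ⟨w, hwu⟩ := hadj
      exact C.mem_supp_of_adj_mem_supp v.2 h
  · rfl

theorem form_eq_sum {x : V → ℝ} (hx : x u = 0) (a : ℝ)
    [Fintype (deleteVertex G u).ConnectedComponent] :
    form G a x = ∑ C : (deleteVertex G u).ConnectedComponent,
      form C.toSimpleGraph a (restrict G u x C) := by
  classical
  cases nonempty_fintype V
  let (C : (deleteVertex G u).ConnectedComponent) : Fintype (ComponentVertex C) := Fintype.ofFinite _
  simp_rw [form_eq]
  rw [← Fintype.sum_sigma'
    (fun (C : (deleteVertex G u).ConnectedComponent) (v : ComponentVertex C) =>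
      restrict G u x C v * shift C.toSimpleGraph a (restrict G u x C) v)]
  symm
  refine Fintype.sum_of_injective
    (fun w : (C : (deleteVertex G u).ConnectedComponent) × ComponentVertex C => w.2.1.1) ?_ _ _
    (fun w hw => ?_) fun w => ?_
  · rintro ⟨_, ⟨v, rfl⟩⟩ ⟨_, ⟨w, rfl⟩⟩ h
    obtain rfl : v = w := Subtype.ext h
    rfl
  · by_cases hwu : w = u
    · simp [hwu, hx]
    · exact absurd ⟨⟨_, ⟨⟨w, hwu⟩, rfl⟩⟩, rfl⟩ hw
  · rw [shift_apply_of_mem hx]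
    rfl

theorem form_glue [Fintype (deleteVertex G u).ConnectedComponent] (a : ℝ)
    (y : ∀ C : (deleteVertex G u).ConnectedComponent, ComponentVertex C → ℝ) :
    form G a (glue G u y) = ∑ C, form C.toSimpleGraph a (y C) := by
  rw [form_eq_sum (glue_self y), restrict_glue]

open Classical in
theorem form_glue_single (a : ℝ) (C : (deleteVertex G u).ConnectedComponent) (y : ComponentVertex C → ℝ) :
    form G a (glue G u (Pi.single C y)) = form C.toSimpleGraph a y := by
  cases nonempty_fintype (deleteVertex G u).ConnectedComponent
  rw [form_glue, Fintype.sum_eq_single C fun D hD => by rw [Pi.single_eq_of_ne hD, form_zero],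
    Pi.single_eq_same]

open Classical in
theorem form_glue_single_add_single (a : ℝ) {C D : (deleteVertex G u).ConnectedComponent}
    (hCD : C ≠ D) (y : ComponentVertex C → ℝ) (z : ComponentVertex D → ℝ) :
    form G a (glue G u (Pi.single C y + Pi.single D z)) =
      form C.toSimpleGraph a y + form D.toSimpleGraph a z := by
  cases nonempty_fintype (deleteVertex G u).ConnectedComponent
  rw [form_glue, Fintype.sum_eq_add C D hCD fun E hE => by
    simp [Pi.single_eq_of_ne hE.1, Pi.single_eq_of_ne hE.2, form_zero]]
  simp [Pi.single_eq_of_ne hCD, Pi.single_eq_of_ne hCD.symm]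

-- A walk from C to u must leave C, and the only exit is u.
omit [Finite V] in
theorem exists_adj_of_connected (hG : G.Connected) (C : (deleteVertex G u).ConnectedComponent) :
    ∃ v : ComponentVertex C, G.Adj u v.1.1 := by
  obtain ⟨v, hv⟩ := C.nonempty_supp
  obtain ⟨p⟩ := hG.preconnected v.1 u
  obtain ⟨d, -, ⟨w, hw⟩, hd2⟩ := p.exists_boundary_dart (Set.range fun w : ComponentVertex C => w.1.1)
    ⟨⟨v, hv⟩, rfl⟩ (by rintro ⟨w, hw⟩; exact w.1.2 hw)
  simp only at hw
  by_cases h : d.snd = u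
  · exact ⟨w, by rw [hw, ← h]; exact d.adj.symm⟩
  · refine absurd ⟨⟨⟨d.snd, h⟩, ?_⟩, rfl⟩ hd2
    have hadj : (deleteVertex G u).Adj w.1 ⟨d.snd, h⟩ := by
      change G.Adj w.1.1 d.snd
      rw [hw]
      exact d.adj
    exact C.mem_supp_of_adj_mem_supp w.2 hadj

open Classical in
/-- The extension by zero of an eigenvector for the index of a component of `G - u` is not an
eigenvector of `G`: the eigenvalue equation fails at `u`. -/
theorem shift_glue_single_ne_zero (hG : G.Connected) (a : ℝ)
    (C : (deleteVertex G u).ConnectedComponent) {y : ComponentVertex C → ℝ} (hy0 : y ≠ 0)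
    (hy : shift C.toSimpleGraph (index C.toSimpleGraph) y = 0) :
    shift G a (glue G u (Pi.single C y)) ≠ 0 := by
  cases nonempty_fintype V
  obtain ⟨s, hs⟩ := exists_mul_pos_of_shift_index_eq_zero C.connected_toSimpleGraph hy0 hy
  obtain ⟨v, hv⟩ := exists_adj_of_connected hG C
  set x := glue G u (Pi.single C y) with hx
  have hres : restrict G u x = Pi.single C y := restrict_glue _
  have hC (w : ComponentVertex C) : x w.1.1 = y w := by
    have := congrFun (congrFun hres C) w
    rwa [Pi.single_eq_same] at this
  have hnonneg (w : V) : 0 ≤ s * x w := by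
    by_cases hw : w = u
    · rw [hw, hx, glue_self, mul_zero]
    · have h := congrFun (congrFun hres ((deleteVertex G u).connectedComponentMk ⟨w, hw⟩))
        ⟨⟨w, hw⟩, rfl⟩
      by_cases hD : (deleteVertex G u).connectedComponentMk ⟨w, hw⟩ = C
      · have := hC ⟨⟨w, hw⟩, hD⟩
        simp only at this
        rw [this]
        exact (hs _).le
      · rw [Pi.single_eq_of_ne hD] at h
        have h' : x w = 0 := h
        rw [h', mul_zero]
  intro h
  have h0 := congrFun h u
  rw [shift_apply, hx, glue_self, ← hx, mul_zero, sub_zero, Pi.zero_apply] at h0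
  -- As x vanishes at u, the equation there says that its neighbour sum is 0, whatever a is.
  have hpos : 0 < s * ∑ w, (if G.Adj u w then x w else 0) := by
    rw [Finset.mul_sum]
    refine Finset.sum_pos' (fun w _ => ?_) ⟨v.1.1, Finset.mem_univ _, ?_⟩
    · split_ifs
      · exact hnonneg w
      · simp
    · rw [if_pos hv, hC]
      exact hs v
  rw [h0, mul_zero] at hpos
  exact hpos.false

theorem two_le_card (C : (deleteVertex G u).ConnectedComponent) : 2 ≤ Nat.card V := by
  obtain ⟨v, -⟩ := C.nonempty_supp
  have : Nontrivial V := ⟨v.1, u, v.2⟩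
  exact Finite.one_lt_card

end Glue

theorem eigenvalue_of_card_lt {V : Type*} [Finite V] (G : SimpleGraph V) {k : ℕ}
    (hk : Nat.card V < k) : eigenvalue G k = 0 := by
  let : Fintype V := Fintype.ofFinite V
  have hn : Nat.card V = Fintype.card V := Nat.card_eq_fintype_card
  rw [eigenvalue, dif_neg]
  rw [← hn]
  omega

theorem exists_combination_eq_zero {E : Type*} [AddCommGroup E] [Module ℝ E] (l : E →ₗ[ℝ] ℝ)
    (p q : E) : ∃ s t : ℝ, (s ≠ 0 ∨ t ≠ 0) ∧ l (s • p + t • q) = 0 := by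
  by_cases h : l p = 0
  · exact ⟨1, 0, by simp, by simp [h]⟩
  · exact ⟨-l q, l p, Or.inr h, by simp; ring⟩

/-! ### Bounds on λ₂(G) from the components -/

section CutVertex

variable {V : Type*} [Finite V] {G : SimpleGraph V} {u : V} {a : ℝ}

instance (C : (deleteVertex G u).ConnectedComponent) : Nonempty (ComponentVertex C) :=
  let ⟨v, hv⟩ := C.nonempty_supp
  ⟨⟨v, hv⟩⟩

open Classical in
omit [Finite V] in
theorem glue_combination (C D : (deleteVertex G u).ConnectedComponent)
    (y : ComponentVertex C → ℝ) (z : ComponentVertex D → ℝ) (s t : ℝ) :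
    s • glue G u (Pi.single C y) + t • glue G u (Pi.single D z) =
      glue G u (Pi.single C (s • y) + Pi.single D (t • z)) := by
  rw [Pi.single_smul, Pi.single_smul, map_add, map_smul, map_smul]

/-- The two Perron vectors extended by zero span a plane on which the form is positive definite. -/
theorem lt_eigenvalue_two_of_lt_index {C D : (deleteVertex G u).ConnectedComponent} (hCD : C ≠ D)
    (hC : a < index C.toSimpleGraph) (hD : a < index D.toSimpleGraph) : a < eigenvalue G 2 := by
  classical
  by_contra! h
  obtain ⟨l, hl⟩ := exists_forall_form_nonpos_of_le G h
  obtain ⟨y, hy0, hy⟩ := exists_shift_index_eq_zero C.toSimpleGraph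
  obtain ⟨z, hz0, hz⟩ := exists_shift_index_eq_zero D.toSimpleGraph
  have hy' := form_lt_of_lt C.toSimpleGraph hC hy0
  have hz' := form_lt_of_lt D.toSimpleGraph hD hz0
  rw [form_eq_zero_of_shift_eq_zero hy] at hy'
  rw [form_eq_zero_of_shift_eq_zero hz] at hz'
  obtain ⟨s, t, hst, hlst⟩ :=
    exists_combination_eq_zero l (glue G u (Pi.single C y)) (glue G u (Pi.single D z))
  have h1 := (hl _ hlst).1
  rw [glue_combination, form_glue_single_add_single a hCD, form_smul, form_smul] at h1
  rcases hst with h0 | h0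
  · nlinarith [mul_pos (sq_pos_of_ne_zero h0) hy', mul_nonneg (sq_nonneg t) hz'.le]
  · nlinarith [mul_pos (sq_pos_of_ne_zero h0) hz', mul_nonneg (sq_nonneg s) hy'.le]

theorem eigenvalue_two_le_of_index_le (C₀ : (deleteVertex G u).ConnectedComponent)
    (h : ∀ C : (deleteVertex G u).ConnectedComponent, index C.toSimpleGraph ≤ a) :
    eigenvalue G 2 ≤ a := by
  cases nonempty_fintype (deleteVertex G u).ConnectedComponent
  by_contra! ha
  obtain ⟨x, hx0, hxu, hx, -⟩ :=
    exists_form_nonneg_of_le G (two_le_card C₀) le_rfl (LinearMap.proj u)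
  refine absurd (hx.trans_lt (form_lt_of_lt G ha hx0)) (not_lt.2 ?_)
  have hxu : x u = 0 := hxu
  rw [form_eq_sum hxu]
  exact Finset.sum_nonpos fun C _ => form_nonpos_of_index_le (h C) _

theorem eigenvalue_two_lt_of_subsingleton (hG : G.Connected)
    (C₀ : (deleteVertex G u).ConnectedComponent)
    (h : ∀ C : (deleteVertex G u).ConnectedComponent, index C.toSimpleGraph ≤ a)
    (hsub : ∀ C D : (deleteVertex G u).ConnectedComponent,
      index C.toSimpleGraph = a → index D.toSimpleGraph = a → C = D) :
    eigenvalue G 2 < a := by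
  classical
  cases nonempty_fintype (deleteVertex G u).ConnectedComponent
  by_contra! ha
  obtain ⟨x, hx0, hxu, hx, hx'⟩ :=
    exists_form_nonneg_of_le G (two_le_card C₀) ha (LinearMap.proj u)
  have hxu : x u = 0 := hxu
  have hle (C : (deleteVertex G u).ConnectedComponent) :=
    form_nonpos_of_index_le (h C) (restrict G u x C)
  have hsum : form G a x = 0 := by
    refine le_antisymm ?_ hx
    rw [form_eq_sum hxu]
    exact Finset.sum_nonpos fun C _ => hle C
  have hform (C : (deleteVertex G u).ConnectedComponent) :
      form C.toSimpleGraph a (restrict G u x C) = 0 := by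
    have h0 := hsum
    rw [form_eq_sum hxu] at h0
    exact (Finset.sum_eq_zero_iff_of_nonpos fun C _ => hle C).1 h0 C (Finset.mem_univ _)
  have hindex (C : (deleteVertex G u).ConnectedComponent) (hC : restrict G u x C ≠ 0) :
      index C.toSimpleGraph = a := by
    by_contra hne
    exact (form_neg_of_index_lt (lt_of_le_of_ne (h C) hne) hC).ne (hform C)
  obtain ⟨C, hC⟩ : ∃ C, restrict G u x C ≠ 0 := by
    by_contra! h0
    apply hx0
    rw [← glue_restrict hxu, show restrict G u x = 0 from funext h0, map_zero]
  -- Only a component of index a can carry a null vector, so x lives on C alone.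
  have hres : restrict G u x = Pi.single C (restrict G u x C) := by
    funext D
    by_cases hD : D = C
    · subst hD
      rw [Pi.single_eq_same]
    · rw [Pi.single_eq_of_ne hD]
      by_contra hne
      exact hD (hsub D C (hindex D hne) (hindex C hC))
  refine shift_glue_single_ne_zero hG a C hC ?_ ?_
  · apply (form_index_nonpos _ _).2
    rw [hindex C hC]
    exact hform C
  · rw [← hres, glue_restrict hxu]
    exact hx' hsum

theorem lt_eigenvalue_two_of_index_eq (hG : G.Connected)
    {C D : (deleteVertex G u).ConnectedComponent} (hC : a < index C.toSimpleGraph)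
    (hD : index D.toSimpleGraph = a) : a < eigenvalue G 2 := by
  classical
  have hCD : C ≠ D := by
    rintro rfl
    exact hC.ne' hD
  by_contra! h
  obtain ⟨l, hl⟩ := exists_forall_form_nonpos_of_le G h
  obtain ⟨y, hy0, hy⟩ := exists_shift_index_eq_zero C.toSimpleGraph
  obtain ⟨z, hz0, hz⟩ := exists_shift_index_eq_zero D.toSimpleGraph
  have hy' := form_lt_of_lt C.toSimpleGraph hC hy0
  rw [form_eq_zero_of_shift_eq_zero hy] at hy'
  have hz' := form_eq_zero_of_shift_eq_zero hz
  rw [hD] at hz'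
  obtain ⟨s, t, hst, hlst⟩ :=
    exists_combination_eq_zero l (glue G u (Pi.single C y)) (glue G u (Pi.single D z))
  obtain ⟨h1, h2⟩ := hl _ hlst
  have hform : form G a (s • glue G u (Pi.single C y) + t • glue G u (Pi.single D z)) =
      s ^ 2 * form C.toSimpleGraph a y := by
    rw [glue_combination, form_glue_single_add_single a hCD, form_smul, form_smul, hz',
      mul_zero, add_zero]
  rw [hform] at h1 h2
  -- A nonzero s would make the form positive on the hyperplane; so the vector from D alone lies
  -- there, is null, and must be an eigenvector of G.
  have hs : s = 0 := by
    by_contra hs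
    exact h1.not_gt (mul_pos (sq_pos_of_ne_zero hs) hy')
  have ht : t ≠ 0 := hst.resolve_left (not_not.2 hs)
  have h3 := h2 (by simp [hs])
  rw [hs, zero_smul, zero_add, map_smul] at h3
  exact shift_glue_single_ne_zero hG a D hz0 hz ((smul_eq_zero.1 h3).resolve_left ht)

theorem lt_eigenvalue_two_of_lt_eigenvalue_two (ha : 0 ≤ a)
    {C : (deleteVertex G u).ConnectedComponent} (hC : a < eigenvalue C.toSimpleGraph 2) :
    a < eigenvalue G 2 := by
  classical
  by_contra! h
  obtain ⟨l, hl⟩ := exists_forall_form_nonpos_of_le G h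
  have hcard : 2 ≤ Nat.card (ComponentVertex C) := by
    by_contra! hlt
    rw [eigenvalue_of_card_lt _ hlt] at hC
    exact hC.not_ge ha
  -- Pulling `l` back along extension by zero gives a hyperplane on C, which meets the top plane of
  -- C.
  obtain ⟨y, hy0, hly, hy, -⟩ := exists_form_nonneg_of_le C.toSimpleGraph hcard le_rfl
    (l ∘ₗ glue G u ∘ₗ LinearMap.single ℝ
      (fun C : (deleteVertex G u).ConnectedComponent => ComponentVertex C → ℝ) C)
  have h1 := (hl (glue G u (Pi.single C y)) hly).1
  rw [form_glue_single] at h1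
  exact h1.not_gt (hy.trans_lt (form_lt_of_lt _ hC hy0))

end CutVertex

end GraphSpectrum

theorem mainTheorem1 {V : Type*} [Finite V] (G : SimpleGraph V) (hG : G.Connected)
    (u : V) (hu : GraphSpectrum.IsCutVertex G u) (a : ℝ) (ha : 0 < a) :
    -- (1) at most one component has index `a`, all the others have index less than `a`
    (((∀ C D : (GraphSpectrum.deleteVertex G u).ConnectedComponent,
          GraphSpectrum.index C.toSimpleGraph = a → GraphSpectrum.index D.toSimpleGraph = a →
            C = D) ∧
        (∀ C : (GraphSpectrum.deleteVertex G u).ConnectedComponent,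
          GraphSpectrum.index C.toSimpleGraph ≠ a → GraphSpectrum.index C.toSimpleGraph < a)) →
      GraphSpectrum.eigenvalue G 2 < a) ∧
    -- (2) at least two components have index `a`, the rest have index at most `a`
    ((∃ C D : (GraphSpectrum.deleteVertex G u).ConnectedComponent, C ≠ D ∧
        GraphSpectrum.index C.toSimpleGraph = a ∧ GraphSpectrum.index D.toSimpleGraph = a ∧
        ∀ E : (GraphSpectrum.deleteVertex G u).ConnectedComponent, E ≠ C → E ≠ D →
          GraphSpectrum.index E.toSimpleGraph ≤ a) →
      GraphSpectrum.eigenvalue G 2 = a) ∧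
    -- (3) at least two components have index greater than `a`
    ((∃ C D : (GraphSpectrum.deleteVertex G u).ConnectedComponent, C ≠ D ∧
        a < GraphSpectrum.index C.toSimpleGraph ∧ a < GraphSpectrum.index D.toSimpleGraph) →
      a < GraphSpectrum.eigenvalue G 2) ∧
    -- (4) exactly one component has index greater than `a`, at least one has index `a`,
    -- the rest have index less than `a`
    ((∃ C : (GraphSpectrum.deleteVertex G u).ConnectedComponent,
        a < GraphSpectrum.index C.toSimpleGraph ∧
        (∃ D : (GraphSpectrum.deleteVertex G u).ConnectedComponent,
          GraphSpectrum.index D.toSimpleGraph = a) ∧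
        ∀ E : (GraphSpectrum.deleteVertex G u).ConnectedComponent, E ≠ C →
          GraphSpectrum.index E.toSimpleGraph = a ∨ GraphSpectrum.index E.toSimpleGraph < a) →
      a < GraphSpectrum.eigenvalue G 2) ∧
    -- (5) one component (with at least two vertices) has `λ₁ > λ₂ > a`,
    -- the rest have index less than `a`
    ((∃ C : (GraphSpectrum.deleteVertex G u).ConnectedComponent,
        2 ≤ Nat.card C ∧
        GraphSpectrum.eigenvalue C.toSimpleGraph 2 < GraphSpectrum.eigenvalue C.toSimpleGraph 1 ∧
        a < GraphSpectrum.eigenvalue C.toSimpleGraph 2 ∧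
        ∀ D : (GraphSpectrum.deleteVertex G u).ConnectedComponent, D ≠ C →
          GraphSpectrum.index D.toSimpleGraph < a) →
      a < GraphSpectrum.eigenvalue G 2) := by
  -- A component besides u shows that G has two vertices, so λ₂(G) is a genuine eigenvalue.
  have hcard : 0 < Nat.card (GraphSpectrum.deleteVertex G u).ConnectedComponent :=
    Nat.zero_lt_of_lt hu
  obtain ⟨⟨C₀⟩, -⟩ := Nat.card_pos_iff.1 hcard
  refine ⟨fun ⟨hsub, hle⟩ => ?_, fun ⟨C, D, hCD, hC, hD, hE⟩ => ?_,
    fun ⟨C, D, hCD, hC, hD⟩ => GraphSpectrum.lt_eigenvalue_two_of_lt_index hCD hC hD,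
    fun ⟨C, hC, ⟨D, hD⟩, _⟩ => GraphSpectrum.lt_eigenvalue_two_of_index_eq hG hC hD,
    fun ⟨C, _, _, hC, _⟩ => GraphSpectrum.lt_eigenvalue_two_of_lt_eigenvalue_two ha.le hC⟩
  · refine GraphSpectrum.eigenvalue_two_lt_of_subsingleton hG C₀ (fun C => ?_) hsub
    by_cases h : GraphSpectrum.index C.toSimpleGraph = a
    · exact h.le
    · exact (hle C h).le
  · refine le_antisymm (GraphSpectrum.eigenvalue_two_le_of_index_le C₀ fun E => ?_) ?_
    · by_cases hEC : E = C
      · rw [hEC]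
        exact hC.le
      by_cases hED : E = D
      · rw [hED]
        exact hD.le
      exact hE E hEC hED
    -- If λ₂(G) < a, case (3) with λ₂(G) itself as threshold gives λ₂(G) < λ₂(G).
    · by_contra! h
      exact (GraphSpectrum.lt_eigenvalue_two_of_lt_index hCD (h.trans_eq hC.symm)
        (h.trans_eq hD.symm)).false
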